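/- Let $\Omega$ be a nonempty Polish space with Borel $\sigma$-algebra $\mathcal F=\mathcal B(\Omega)$, let $T\ge 1$, $d\ge 1$, let $\mathbb F=(\mathcal F_t)_{t=0,\dots,T}$ be a filtration with $\mathcal F_0=\{\varnothing,\Omega\}$ and $\mathcal F_T\subseteq\mathcal F$, and let $S=(S_t)_{t=0,\dots,T}$ be an $\mathbb F$-adapted $\mathbb R^d$-valued process (the discounted prices of $d$ risky assets). A trading strategy is an $\mathbb R^d$-valued process $H=(H_t)_{t=1,\dots,T}$ with $H_t$ $\mathcal F_{t-1}$-measurable; its value is $V_0(H)=0$, $V_t(H)=\sum_{i=1}^t H_i\cdot(S_i-S_{i-1})$. A strategy $H$ with $V_T(H)(\omega)\ge 0$ for all $\omega\in\Omega$ is a $1p$-Arbitrage if $\{V_T(H)>0\}$ contains a nonempty Borel set, and an Open Arbitrage if $\{V_T(H)>0\}$ contains a nonempty open set. Let $\mathcal M_+$ be the set of Borel probability measures $Q$ on $\Omega$ with full support (that is, $\operatorname{supp}(Q)=\Omega$) under which $S$ is an $\mathbb F$-martingale. 1. Suppose that $\mathbb F$ is the natural filtration of $S$, i.e. $\mathcal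 F_t=\sigma(S_0,\dots,S_t)$ for all $t$. If there is no $1p$-Arbitrage, then $\mathcal M_+\neq\varnothing$. 2. (For every filtration $\mathbb F$ as above.) If $\mathcal M_+\neq\varnothing$, then there is no Open Arbitrage. -/

import Mathlib

open MeasureTheory Set

/-- A frictionless discrete-time market on the measurable space `Ω` with time indices `0, …, T`,
a riskless asset constantly equal to `1`, and `d` risky assets: a filtration with trivial initial
σ-algebra and an adapted `ℝ^d`-valued (discounted) price process. -/
structure Market (Ω : Type*) [MeasurableSpace Ω] (T d : ℕ) where
  /-- the filtration `(𝓕_t)`, `t = 0, …, T` -/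
  filtration : Filtration (Fin (T + 1)) (‹MeasurableSpace Ω› : MeasurableSpace Ω)
  /-- `𝓕_0 = {∅, Ω}` -/
  initial_trivial : filtration 0 = ⊥
  /-- the price process `(S_t)`, `t = 0, …, T` -/
  price : Fin (T + 1) → Ω → EuclideanSpace ℝ (Fin d)
  /-- `S_t` is `𝓕_t`-measurable -/
  adapted : Adapted filtration price

namespace Market

variable {Ω : Type*} [MeasurableSpace Ω] {T d : ℕ}

/-- The natural filtration `𝓕^S_t = σ(S_0, …, S_t)` of the price process. -/
def naturalFiltration (M : Market Ω T d) :
    Filtration (Fin (T + 1)) (‹MeasurableSpace Ω› : MeasurableSpace Ω) :=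
  Filtration.natural M.price fun t =>
    ((M.adapted t).mono (M.filtration.le t) le_rfl).stronglyMeasurable

/-- The trading strategies: predictable `ℝ^d`-valued processes `(H_t)`, `t = 1, …, T`.
The index `i : Fin T` stands for the trading period from time `i` to time `i + 1`, so that
`pos i` is `H_{i+1}`, which has to be `𝓕_i`-measurable. -/
structure Strategy (M : Market Ω T d) where
  /-- the positions held in the risky assets -/
  pos : Fin T → Ω → EuclideanSpace ℝ (Fin d)
  /-- `H_{i+1}` is `𝓕_i`-measurable -/
  predictable : ∀ i : Fin T, Measurable[M.filtration i.castSucc] (pos i)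

/-- The value `V_t(H) = ∑_{i=1}^t H_i · (S_i - S_{i-1})` of a strategy of zero initial cost. -/
noncomputable def value (M : Market Ω T d) (H : M.Strategy) (t : Fin (T + 1)) (ω : Ω) : ℝ :=
  ∑ i : Fin T with i.castSucc < t,
    inner ℝ (H.pos i ω) (M.price i.succ ω - M.price i.castSucc ω)

/-- The set `{ω | V_T(H)(ω) > 0}` on which the strategy makes a strict gain. -/
def gainSet (M : Market Ω T d) (H : M.Strategy) : Set Ω :=
  {ω | 0 < M.value H (Fin.last T) ω}

/-- `H` is an Arbitrage de la classe `𝒮`. -/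
def IsArbitrage (M : Market Ω T d) (𝒮 : Set (Set Ω)) (H : M.Strategy) : Prop :=
  (∀ ω, M.value H 0 ω = 0) ∧ (∀ ω, 0 ≤ M.value H (Fin.last T) ω) ∧ ∃ C ∈ 𝒮, C ⊆ M.gainSet H

/-- No strategy is a one-point arbitrage (`1p`-Arbitrage). -/
def NoOnePointArbitrage (M : Market Ω T d) : Prop :=
  ¬ ∃ H : M.Strategy, M.IsArbitrage {C | MeasurableSet C ∧ C.Nonempty} H

/-- No strategy is an Open Arbitrage. -/
def NoOpenArbitrage [TopologicalSpace Ω] (M : Market Ω T d) : Prop :=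
  ¬ ∃ H : M.Strategy, M.IsArbitrage {C | MeasurableSet C ∧ IsOpen C ∧ C.Nonempty} H

/-- The set `𝓜` of martingale measures: the probability measures under which the price process
is a martingale with respect to the filtration of the market. -/
def martingaleMeasures (M : Market Ω T d) : Set (ProbabilityMeasure Ω) :=
  {Q | Martingale M.price M.filtration (Q : Measure Ω)}

/-- The set `𝓜_+` of martingale measures of full support. -/
def fullSupportMartingaleMeasures [TopologicalSpace Ω] (M : Market Ω T d) :
    Set (ProbabilityMeasure Ω) :=
  {Q | Q ∈ M.martingaleMeasures ∧ (Q : Measure Ω).support = univ}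

end Market

/-! Part 1. For the natural filtration, the scenarios sharing a price path up to `t` form an atom of
`𝓕_t`. Backward induction on `t` gives each `ω` a finite measure that charges `ω`, lives on its atom
and makes `S` a martingale from `t` on (`exists_isMartingaleFrom_pos`). Without 1p-arbitrage, no
vector has a nonnegative, nontrivial inner product with the increments on an atom, so their conic
hull is a linear subspace (`neg_mem_span_nnreal_of_forall_inner`). Hence minus the increment at `ω`
is a finite conic combination of increments, and adding the same combination of later measures
centres the period. Finite combinations make measurable selection unnecessary. A weighted sum over a
dense sequence of scenarios has full support.

Part 2. Under a martingale measure, nonnegative terminal value forces zero terminal value almost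
surely (`value_ae_eq_zero`), whereas full support charges every nonempty open set. -/

/-! ### Convex cones in finite dimension -/

/-- In finite dimension, the cone generated by a set on which no linear functional is nonnegative
and nontrivial is a linear subspace. -/
theorem neg_mem_span_nnreal_of_forall_inner {E : Type*} [NormedAddCommGroup E]
    [InnerProductSpace ℝ E] [FiniteDimensional ℝ E] {D : Set E}
    (hD : ∀ h : E, (∀ y ∈ D, 0 ≤ inner ℝ h y) → ∀ y ∈ D, inner ℝ h y = 0) {x : E} (hx : x ∈ D) :
    -x ∈ Submodule.span NNReal D := by
  -- Relative to the span of `D` the cone has nonempty interior, so separation applies without the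
  -- cone being closed.
  set W := Submodule.span ℝ D with hW
  let C : Set W := {w | (w : E) ∈ Submodule.span NNReal D}
  have hsmul : ∀ (c : ℝ), 0 ≤ c → ∀ w ∈ C, c • w ∈ C := fun c hc w hw =>
    Submodule.smul_mem (Submodule.span NNReal D) (⟨c, hc⟩ : NNReal) hw
  have hadd : ∀ w ∈ C, ∀ z ∈ C, w + z ∈ C := fun w hw z hz =>
    (Submodule.span NNReal D).add_mem (x := (w : E)) (y := z) hw hz
  have hzero : (0 : W) ∈ C := Submodule.zero_mem (Submodule.span NNReal D)
  have hconv : Convex ℝ C := fun w hw z hz a b ha hb _ =>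
    hadd _ (hsmul a ha w hw) _ (hsmul b hb z hz)
  have hDC : ∀ y (hy : y ∈ D), (⟨y, Submodule.subset_span hy⟩ : W) ∈ C := fun y hy =>
    Submodule.subset_span hy
  have hspan : Submodule.span ℝ C = ⊤ := by
    rw [eq_top_iff, ← Submodule.span_span_coe_preimage (R := ℝ) (s := D)]
    exact Submodule.span_mono fun w hw => hDC w hw
  have hint : (interior C).Nonempty := by
    rw [hconv.interior_nonempty_iff_affineSpan_eq_top]
    rw [← AffineSubspace.coe_eq_univ_iff, ← insert_eq_of_mem hzero, affineSpan_insert_zero, hspan]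
    rfl
  by_contra hcon
  set x' : W := ⟨x, Submodule.subset_span hx⟩ with hx'
  obtain ⟨f, hf⟩ := geometric_hahn_banach_open_point (x := -x') hconv.interior isOpen_interior
    (fun h => hcon (show -x' ∈ C from interior_subset h))
  have hle : ∀ a ∈ C, f a ≤ f (-x') := by
    intro a ha
    have hcl : a ∈ closure (interior C) := by
      rw [hconv.closure_interior_eq_closure_of_nonempty_interior hint]
      exact subset_closure ha
    exact closure_minimal (t := {a | f a ≤ f (-x')}) (fun b hb => (hf b hb).le)
      (isClosed_le f.continuous continuous_const) hcl
  have hnonpos : ∀ a ∈ C, f a ≤ 0 := by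
    intro a ha
    by_contra! hpos
    have h0 : 0 ≤ f (-x') := by simpa using hle 0 hzero
    -- This multiple of `a` stays in the cone, yet `f` takes the value `f (-x') + 1` there, above
    -- the bound.
    have := hle _ (hsmul ((f (-x') + 1) / f a) (by positivity) a ha)
    rw [map_smul, smul_eq_mul, div_mul_cancel₀ _ hpos.ne'] at this
    linarith
  set h : W := (InnerProductSpace.toDual ℝ W).symm f
  have hin : ∀ y (hy : y ∈ D), inner ℝ (-(h : E)) y = - f ⟨y, Submodule.subset_span hy⟩ := by
    intro y hy
    rw [← InnerProductSpace.toDual_symm_apply (𝕜 := ℝ), inner_neg_left]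
    rfl
  have hz := hD (-(h : E)) fun y hy => by
    rw [hin y hy]; linarith [hnonpos _ (hDC y hy)]
  have hf0 : (f : W →ₗ[ℝ] ℝ) = 0 := by
    refine LinearMap.ext_on (s := ((↑) : W → E) ⁻¹' D) Submodule.span_span_coe_preimage ?_
    intro w hw
    have := hz w hw
    rw [hin w hw] at this
    simpa using this
  obtain ⟨a, ha⟩ := hint
  have h1 := hf a ha
  have h2 : ∀ w, f w = 0 := fun w => LinearMap.congr_fun hf0 w
  rw [h2, h2] at h1
  exact lt_irrefl _ h1

/-! ### Atoms of the price history and one-period arbitrage -/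

namespace Market

variable {Ω : Type*} [MeasurableSpace Ω] {T d : ℕ}

/-- The increment `S_{i+1} - S_i` of the price process. -/
def increment (M : Market Ω T d) (i : Fin T) (ω : Ω) : EuclideanSpace ℝ (Fin d) :=
  M.price i.succ ω - M.price i.castSucc ω

/-- The scenarios with the same prices as `ω` up to time `t`. -/
def level (M : Market Ω T d) (t : ℕ) (ω : Ω) : Set Ω :=
  {ω' | ∀ s : Fin (T + 1), (s : ℕ) ≤ t → M.price s ω' = M.price s ω}

theorem mem_level_self (M : Market Ω T d) (t : ℕ) (ω : Ω) : ω ∈ M.level t ω := fun _ _ => rfl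

theorem level_anti (M : Market Ω T d) {s t : ℕ} (hst : s ≤ t) (ω : Ω) :
    M.level t ω ⊆ M.level s ω := fun _ h r hr => h r (hr.trans hst)

theorem level_eq_of_mem (M : Market Ω T d) {t : ℕ} {ω ω' : Ω} (h : ω' ∈ M.level t ω) :
    M.level t ω' = M.level t ω := by
  ext x
  exact ⟨fun hx s hs => (hx s hs).trans (h s hs), fun hx s hs => (hx s hs).trans (h s hs).symm⟩

theorem measurable_price (M : Market Ω T d) (s : Fin (T + 1)) : Measurable (M.price s) :=
  (M.adapted s).mono (M.filtration.le s) le_rfl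

theorem measurableSet_level (M : Market Ω T d) (t : Fin (T + 1)) (ω : Ω) :
    MeasurableSet[M.filtration t] (M.level t ω) := by
  have : M.level t ω = ⋂ s : Fin (T + 1), ⋂ _ : s ≤ t, M.price s ⁻¹' {M.price s ω} := by
    ext x; simp [level]
  rw [this]
  refine MeasurableSet.iInter fun s => MeasurableSet.iInter fun hs => ?_
  exact M.filtration.mono hs _ (M.adapted s (measurableSet_singleton _))

/-- The level sets are atoms of the natural filtration. -/
theorem mem_iff_of_mem_level (M : Market Ω T d) (hM : M.filtration = M.naturalFiltration)
    {t : Fin (T + 1)} {ω ω' : Ω} (h : ω' ∈ M.level t ω) {A : Set Ω}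
    (hA : MeasurableSet[M.filtration t] A) : ω' ∈ A ↔ ω ∈ A := by
  rw [hM, naturalFiltration, Filtration.natural_eq_comap] at hA
  obtain ⟨B, -, rfl⟩ := hA
  have : (fun j : Set.Iic t => M.price j ω') = fun j : Set.Iic t => M.price j ω :=
    funext fun j => h j j.2
  simp only [mem_preimage, this]

theorem value_last (M : Market Ω T d) (H : M.Strategy) (ω : Ω) :
    M.value H (Fin.last T) ω = ∑ i, inner ℝ (H.pos i ω) (M.increment i ω) := by
  simp [value, increment, Fin.castSucc_lt_last]

theorem value_zero (M : Market Ω T d) (H : M.Strategy) (ω : Ω) : M.value H 0 ω = 0 := by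
  simp [value]

/-- Without one-point arbitrage there is no arbitrage over one period on a level set. -/
theorem NoOnePointArbitrage.inner_increment_eq_zero {M : Market Ω T d}
    (hM : M.NoOnePointArbitrage) (t : Fin T) (ω : Ω) (h : EuclideanSpace ℝ (Fin d))
    (hh : ∀ x ∈ M.level t ω, 0 ≤ inner ℝ h (M.increment t x)) :
    ∀ x ∈ M.level t ω, inner ℝ h (M.increment t x) = 0 := by
  classical
  intro x hx
  by_contra hne
  let H : M.Strategy :=
    -- Hold `h` during period `t` only, and only on the given atom.
    { pos := fun i => if i = t then (M.level t ω).indicator fun _ => h else 0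
      predictable := fun i => by
        by_cases hi : i = t
        · subst hi
          simp only [if_true]
          exact measurable_const.indicator (M.measurableSet_level i.castSucc ω)
        · simp only [hi, if_false]
          exact measurable_const }
  have hval : ∀ y, M.value H (Fin.last T) y =
      (M.level t ω).indicator (fun y => inner ℝ h (M.increment t y)) y := by
    intro y
    rw [value_last, Finset.sum_eq_single t]
    · by_cases hy : y ∈ M.level t ω <;> simp [H, hy]
    · intro i _ hi; simp [H, hi]
    · simp
  refine hM ⟨H, M.value_zero H, fun y => ?_, M.gainSet H, ⟨?_, x, ?_⟩, subset_rfl⟩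
  · rw [hval]; exact indicator_nonneg hh y
  · refine measurableSet_lt measurable_const ?_
    simp_rw [funext hval]
    refine Measurable.indicator ?_ (M.filtration.le _ _ (M.measurableSet_level t.castSucc ω))
    exact measurable_const.inner ((M.measurable_price _).sub (M.measurable_price _))
  · simp only [gainSet, mem_ofPred_eq, hval, indicator_of_mem hx]
    exact lt_of_le_of_ne (hh x hx) (Ne.symm hne)

/-! ### Martingale measures from a given time on -/

/-- A finite measure integrates the prices and its increments from time `t` on are orthogonal to
the past. -/
structure IsMartingaleFrom (M : Market Ω T d) (t : ℕ) (Q : Measure Ω) : Prop where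
  finite : IsFiniteMeasure Q
  integrable : ∀ s, Integrable (M.price s) Q
  setIntegral_increment : ∀ i : Fin T, t ≤ i → ∀ A, MeasurableSet[M.filtration i.castSucc] A →
    ∫ ω in A, M.increment i ω ∂Q = 0

namespace IsMartingaleFrom

variable {M : Market Ω T d} {t : ℕ} {Q R : Measure Ω}

theorem integrable_increment (hQ : M.IsMartingaleFrom t Q) (i : Fin T) :
    Integrable (M.increment i) Q := (hQ.integrable _).sub (hQ.integrable _)

/-- Without normalisation these measures form a convex cone, so conic combinations of increments
lift to measures. -/
theorem zero : M.IsMartingaleFrom t 0 :=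
  ⟨inferInstance, fun _ => integrable_zero_measure, fun _ _ _ _ => by simp⟩

theorem add (hQ : M.IsMartingaleFrom t Q) (hR : M.IsMartingaleFrom t R) :
    M.IsMartingaleFrom t (Q + R) := by
  have := hQ.finite
  have := hR.finite
  refine ⟨inferInstance, fun s => (hQ.integrable s).add_measure (hR.integrable s),
    fun i hi A hA => ?_⟩
  rw [Measure.restrict_add, integral_add_measure (hQ.integrable_increment i).integrableOn
    (hR.integrable_increment i).integrableOn, hQ.setIntegral_increment i hi A hA,
    hR.setIntegral_increment i hi A hA, add_zero]

theorem smul (hQ : M.IsMartingaleFrom t Q) (c : NNReal) : M.IsMartingaleFrom t (c • Q) := by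
  have := hQ.finite
  refine ⟨inferInstance, fun s => (hQ.integrable s).smul_measure_nnreal, fun i hi A hA => ?_⟩
  rw [Measure.restrict_smul, integral_smul_nnreal_measure, hQ.setIntegral_increment i hi A hA,
    smul_zero]

theorem martingale (hQ : M.IsMartingaleFrom 0 Q) : Martingale M.price M.filtration Q := by
  have := hQ.finite
  have key : ∀ i j : Fin (T + 1), i ≤ j → ∀ A, MeasurableSet[M.filtration i] A →
      ∫ ω in A, M.price i ω ∂Q = ∫ ω in A, M.price j ω ∂Q := by
    intro i j
    induction j using Fin.induction with
    | zero => intro hij A _; rw [Fin.le_zero_iff.1 hij]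
    | succ k ih =>
      intro hij A hA
      rcases hij.eq_or_lt with rfl | hlt
      · rfl
      have hik : i ≤ k.castSucc := Fin.le_castSucc_iff.2 hlt
      have h := hQ.setIntegral_increment k (Nat.zero_le _) A (M.filtration.mono hik _ hA)
      simp only [increment] at h
      rw [integral_sub (hQ.integrable _).integrableOn (hQ.integrable _).integrableOn,
        sub_eq_zero] at h
      rw [ih hik A hA, h]
  have hadp : StronglyAdapted M.filtration M.price := M.adapted.stronglyAdapted
  refine ⟨hadp, fun i j hij => ?_⟩
  exact (ae_eq_condExp_of_forall_setIntegral_eq (M.filtration.le i) (hQ.integrable j)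
    (fun s _ _ => (hQ.integrable i).integrableOn) (fun s hs _ => key i j hij s hs)
    (hadp i).aestronglyMeasurable).symm

end IsMartingaleFrom

/-- Without one-point arbitrage, every scenario is charged by a martingale measure. -/
theorem exists_isMartingaleFrom_pos [MeasurableSingletonClass Ω] {M : Market Ω T d}
    (hnat : M.filtration = M.naturalFiltration) (hM : M.NoOnePointArbitrage) {t : ℕ} (ht : t ≤ T)
    (ω : Ω) : ∃ Q : Measure Ω, M.IsMartingaleFrom t Q ∧ (∀ᵐ x ∂Q, x ∈ M.level t ω) ∧
      0 < Q {ω} := by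
  induction ht using Nat.decreasingInduction generalizing ω with
  | self =>
    refine ⟨Measure.dirac ω, ⟨inferInstance, fun s => ?_, fun i hi => ?_⟩, ?_, by simp⟩
    · exact integrable_dirac (by simp)
    · exact absurd i.2 (not_lt.2 hi)
    · rw [ae_dirac_eq]; exact M.mem_level_self T ω
  | of_succ t ht ih =>
    let i : Fin T := ⟨t, ht⟩
    have hmeas : MeasurableSet[M.filtration i.castSucc] (M.level t ω) :=
      M.measurableSet_level i.castSucc ω
    have hconst : ∀ y, ∀ x ∈ M.level (t + 1) y, M.increment i x = M.increment i y := by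
      intro y x hx
      simp only [increment]
      rw [hx i.succ (by simp [i]), hx i.castSucc (by simp [i])]
    have hbase : ∀ y ∈ M.level t ω, ∃ Q : Measure Ω, M.IsMartingaleFrom (t + 1) Q ∧
        (∀ᵐ x ∂Q, x ∈ M.level t ω) ∧ 0 < Q {y} ∧ ∫ x, M.increment i x ∂Q = M.increment i y := by
      intro y hy
      obtain ⟨Q, hQ, hlev, hpos⟩ := ih y
      have := hQ.finite
      have hu : 0 < Q univ := hpos.trans_le (measure_mono (subset_univ _))
      have hint : ∫ x, M.increment i x ∂Q = Q.real univ • M.increment i y := by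
        rw [integral_congr_ae (hlev.mono (hconst y)), integral_const]
      have hr : 0 < Q.real univ := ENNReal.toReal_pos hu.ne' (measure_ne_top _ _)
      -- Normalised to mass one, since the increment is almost surely constant under `Q`: its
      -- integral becomes its value at `y`.
      let c : NNReal := (Q univ).toNNReal⁻¹
      have hc : 0 < c := inv_pos.2 (ENNReal.toNNReal_pos hu.ne' (measure_ne_top _ _))
      refine ⟨c • Q, hQ.smul c, ?_, ?_, ?_⟩
      · refine Measure.ae_smul_measure (hlev.mono fun x hx => ?_) c
        rw [← M.level_eq_of_mem hy]
        exact M.level_anti (Nat.le_succ t) y hx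
      · rw [Measure.smul_apply]
        exact pos_iff_ne_zero.2 (smul_ne_zero hc.ne' hpos.ne')
      · rw [integral_smul_nnreal_measure, hint, NNReal.smul_def, smul_smul]
        have : (c : ℝ) * Q.real univ = 1 := inv_mul_cancel₀ hr.ne'
        rw [this, one_smul]
    have hcone := neg_mem_span_nnreal_of_forall_inner (D := M.increment i '' M.level t ω)
      (by
        simp only [forall_mem_image]
        exact fun h hh => hM.inner_increment_eq_zero i ω h hh)
      (mem_image_of_mem _ (M.mem_level_self t ω))
    have hrep : ∀ v ∈ Submodule.span NNReal (M.increment i '' M.level t ω), ∃ Q : Measure Ω,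
        M.IsMartingaleFrom (t + 1) Q ∧ (∀ᵐ x ∂Q, x ∈ M.level t ω) ∧
          ∫ x, M.increment i x ∂Q = v := by
      intro v hv
      induction hv using Submodule.span_induction with
      | mem v hv =>
        obtain ⟨y, hy, rfl⟩ := hv
        obtain ⟨Q, h1, h2, -, h3⟩ := hbase y hy
        exact ⟨Q, h1, h2, h3⟩
      | zero => exact ⟨0, .zero, by simp, by simp⟩
      | add v w _ _ hv hw =>
        obtain ⟨Q, h1, h2, h3⟩ := hv
        obtain ⟨R, k1, k2, k3⟩ := hw
        refine ⟨Q + R, h1.add k1, ae_add_measure_iff.2 ⟨h2, k2⟩, ?_⟩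
        rw [integral_add_measure (h1.integrable_increment i) (k1.integrable_increment i), h3, k3]
      | smul c v _ hv =>
        obtain ⟨Q, h1, h2, h3⟩ := hv
        refine ⟨c • Q, h1.smul c, Measure.ae_smul_measure h2 c, ?_⟩
        rw [integral_smul_nnreal_measure, h3]
    obtain ⟨Q, hQ, hQl, hQpos, hQi⟩ := hbase ω (M.mem_level_self t ω)
    obtain ⟨R, hR, hRl, hRi⟩ := hrep _ hcone
    have hl : ∀ᵐ x ∂(Q + R), x ∈ M.level t ω := ae_add_measure_iff.2 ⟨hQl, hRl⟩
    have hQR := hQ.add hR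
    refine ⟨Q + R, ⟨hQR.finite, hQR.integrable, fun j hj A hA => ?_⟩, hl, ?_⟩
    · rcases hj.eq_or_lt with hj | hj
      · have hij : i = j := Fin.ext hj
        subst hij
        -- An event of `𝓕_t` contains the atom carrying `Q + R` or misses it, so only the total
        -- integral matters.
        by_cases hω : ω ∈ A
        · have : ∀ᵐ x ∂(Q + R), x ∈ A := hl.mono fun x hx =>
            (M.mem_iff_of_mem_level hnat (t := i.castSucc) hx hA).2 hω
          rw [Measure.restrict_eq_self_of_ae_mem this,
            integral_add_measure (hQ.integrable_increment i) (hR.integrable_increment i), hQi, hRi,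
            add_neg_cancel]
        · have : (Q + R) A = 0 := measure_eq_zero_iff_ae_notMem.2 <| hl.mono fun x hx h =>
            hω ((M.mem_iff_of_mem_level hnat (t := i.castSucc) hx hA).1 h)
          rw [Measure.restrict_eq_zero.2 this, integral_zero_measure]
      · exact hQR.setIntegral_increment j hj A hA
    · rw [Measure.add_apply]
      exact hQpos.trans_le le_self_add

theorem fullSupportMartingaleMeasures_nonempty [TopologicalSpace Ω]
    [TopologicalSpace.SeparableSpace Ω] [Nonempty Ω] [MeasurableSingletonClass Ω]
    {M : Market Ω T d} (hnat : M.filtration = M.naturalFiltration) (hM : M.NoOnePointArbitrage) :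
    M.fullSupportMartingaleMeasures.Nonempty := by
  choose Q hQ _ hpos using exists_isMartingaleFrom_pos hnat hM (Nat.zero_le T)
  let u := TopologicalSpace.denseSeq Ω
  have hfin := fun n => (hQ (u n)).finite
  -- The weights control masses and first moments together, so the sum is finite and integrates the
  -- prices.
  obtain ⟨c, hc, hsum⟩ := ENNReal.exists_pos_tsum_mul_lt_of_countable one_ne_zero
    (fun n => Q (u n) univ + ∑ s, ∫⁻ x, ‖M.price s x‖ₑ ∂Q (u n)) (fun n =>
      ENNReal.add_ne_top.2 ⟨measure_ne_top _ _, ENNReal.sum_ne_top.2 fun s _ =>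
        ((hQ (u n)).integrable s).2.ne⟩)
  set R : Measure Ω := Measure.sum fun n => c n • Q (u n) with hRdef
  have hRuniv : R univ < ⊤ := by
    rw [hRdef, Measure.sum_apply _ MeasurableSet.univ]
    refine (ENNReal.tsum_le_tsum fun n => ?_).trans_lt (hsum.trans ENNReal.one_lt_top)
    rw [Measure.smul_apply, mul_comm]
    exact mul_le_mul_right le_self_add _
  have hRfin : IsFiniteMeasure R := ⟨hRuniv⟩
  have hRint : ∀ s, Integrable (M.price s) R := by
    intro s
    refine ⟨(M.measurable_price s).aestronglyMeasurable, ?_⟩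
    rw [HasFiniteIntegral, hRdef, lintegral_sum_measure]
    refine (ENNReal.tsum_le_tsum fun n => ?_).trans_lt (hsum.trans ENNReal.one_lt_top)
    rw [lintegral_smul_measure, mul_comm]
    refine mul_le_mul_right ?_ _
    exact (Finset.single_le_sum (f := fun s => ∫⁻ x, ‖M.price s x‖ₑ ∂Q (u n))
      (fun _ _ => zero_le) (Finset.mem_univ s)).trans le_add_self
  have hR : M.IsMartingaleFrom 0 R := by
    refine ⟨hRfin, hRint, fun i hi A hA => ?_⟩
    have hI : Integrable (M.increment i) R := (hRint _).sub (hRint _)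
    have hAm := M.filtration.le _ _ hA
    rw [hRdef] at hI ⊢
    have hI' := hI.integrableOn (s := A)
    rw [IntegrableOn, Measure.restrict_sum _ hAm] at hI'
    rw [Measure.restrict_sum _ hAm, integral_sum_measure hI']
    simp only [((hQ _).smul _).setIntegral_increment i hi A hA, tsum_zero]
  have hRpos : ∀ n, 0 < R {u n} := fun n =>
    lt_of_lt_of_le (pos_iff_ne_zero.2 (smul_ne_zero (hc n).ne' (hpos (u n)).ne'))
      (Measure.le_sum (fun n => c n • Q (u n)) n {u n})
  have hR0 : R univ ≠ 0 := ((hRpos 0).trans_le (measure_mono (subset_univ _))).ne'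
  let k : NNReal := (R univ).toNNReal⁻¹
  have hk : k ≠ 0 := inv_ne_zero (ENNReal.toNNReal_pos hR0 hRuniv.ne).ne'
  have hprob : IsProbabilityMeasure (k • R) := ⟨by
    rw [Measure.smul_apply, ENNReal.smul_def, smul_eq_mul,
      ENNReal.coe_inv (ENNReal.toNNReal_pos hR0 hRuniv.ne).ne', ENNReal.coe_toNNReal hRuniv.ne,
      ENNReal.inv_mul_cancel hR0 hRuniv.ne]⟩
  refine ⟨⟨k • R, hprob⟩, (hR.smul k).martingale, ?_⟩
  refine eq_univ_of_forall fun x => ?_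
  rw [Measure.mem_support_iff_forall]
  intro U hU
  obtain ⟨V, hVU, hV, hxV⟩ := mem_nhds_iff.1 hU
  obtain ⟨n, hn⟩ := (TopologicalSpace.denseRange_denseSeq Ω).exists_mem_open hV ⟨x, hxV⟩
  refine lt_of_lt_of_le ?_ (measure_mono (singleton_subset_iff.2 (hVU hn)))
  change 0 < (k • R) {u n}
  rw [Measure.smul_apply]
  exact pos_iff_ne_zero.2 (smul_ne_zero hk (hRpos n).ne')

/-! ### Gains under a martingale measure -/

/-- A one-period gain that is nonnegative on an event of the past vanishes there. -/
theorem inner_increment_ae_eq_zero {M : Market Ω T d} {Q : Measure Ω} [IsFiniteMeasure Q]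
    (hQ : Martingale M.price M.filtration Q) (i : Fin T) {H : Ω → EuclideanSpace ℝ (Fin d)}
    (hH : Measurable[M.filtration i.castSucc] H) {A : Set Ω}
    (hA : MeasurableSet[M.filtration i.castSucc] A)
    (hnn : ∀ᵐ x ∂Q, x ∈ A → 0 ≤ inner ℝ (H x) (M.increment i x)) :
    ∀ᵐ x ∂Q, x ∈ A → inner ℝ (H x) (M.increment i x) = 0 := by
  have hle := M.filtration.le i.castSucc
  have hI : Integrable (M.increment i) Q := (hQ.integrable _).sub (hQ.integrable _)
  have hcond : Q[M.increment i | M.filtration i.castSucc] =ᵐ[Q] 0 := by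
    have h1 := condExp_sub (hQ.integrable i.succ) (hQ.integrable i.castSucc)
      (M.filtration i.castSucc)
    filter_upwards [h1, hQ.2 i.castSucc i.succ (Fin.castSucc_le_succ i),
      hQ.2 i.castSucc i.castSucc le_rfl] with x h1 h2 h3
    have h4 : Q[M.increment i | M.filtration i.castSucc] x = _ := h1
    rw [h4, Pi.sub_apply, h2, h3, sub_self, Pi.zero_apply]
  have key : ∀ n : ℕ, ∀ᵐ x ∂Q, x ∈ A → ‖H x‖ ≤ n → inner ℝ (H x) (M.increment i x) = 0 := by
    intro n
    -- `H` need not be bounded, so the gain may fail to be integrable; truncation at level `n`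
    -- allows `H` to be pulled out of the conditional expectation.
    set B := A ∩ {x | ‖H x‖ ≤ n}
    have hB : MeasurableSet[M.filtration i.castSucc] B :=
      hA.inter (measurableSet_le (measurable_norm.comp hH) measurable_const)
    have hf : StronglyMeasurable[M.filtration i.castSucc] (B.indicator H) :=
      hH.stronglyMeasurable.indicator hB
    have hbd : ∀ x, ‖B.indicator H x‖ ≤ n := by
      intro x
      by_cases hx : x ∈ B
      · rw [indicator_of_mem hx]; exact hx.2
      · rw [indicator_of_notMem hx, norm_zero]; exact n.cast_nonneg
    have hpull := condExp_stronglyMeasurable_bilin_of_bound (innerSL ℝ) hle hf hI n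
      (ae_of_all _ hbd)
    have hint : Integrable (fun x => innerSL ℝ (B.indicator H x) (M.increment i x)) Q :=
      (innerSL ℝ).integrable_of_bilin_of_bdd_left (n : ℝ) (hf.mono hle).aestronglyMeasurable
        (ae_of_all _ hbd) hI
    have hzero : ∫ x, innerSL ℝ (B.indicator H x) (M.increment i x) ∂Q = 0 := by
      rw [← integral_condExp hle, integral_congr_ae hpull]
      refine (integral_congr_ae (g := 0) ?_).trans (integral_zero _ _)
      filter_upwards [hcond] with x hx
      rw [hx, Pi.zero_apply, map_zero]
      rfl
    rw [integral_eq_zero_iff_of_nonneg_ae ?_ hint] at hzero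
    · filter_upwards [hzero] with x hx hxA hxn
      have hxB : x ∈ B := ⟨hxA, hxn⟩
      simpa [indicator_of_mem hxB] using hx
    · filter_upwards [hnn] with x hx
      by_cases hxB : x ∈ B
      · simpa [indicator_of_mem hxB] using hx hxB.1
      · simp [indicator_of_notMem hxB]
  filter_upwards [ae_all_iff.2 key] with x hx hxA
  obtain ⟨n, hn⟩ := exists_nat_ge ‖H x‖
  exact hx n hxA hn

theorem value_succ (M : Market Ω T d) (H : M.Strategy) (i : Fin T) (ω : Ω) :
    M.value H i.succ ω = M.value H i.castSucc ω + inner ℝ (H.pos i ω) (M.increment i ω) := by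
  classical
  have : (Finset.univ.filter fun j : Fin T => j.castSucc < i.succ) =
      insert i (Finset.univ.filter fun j : Fin T => j.castSucc < i.castSucc) := by
    ext j
    simp only [Finset.mem_filter, Finset.mem_univ, true_and, Finset.mem_insert,
      Fin.castSucc_lt_succ_iff, Fin.castSucc_lt_castSucc_iff, le_iff_eq_or_lt]
  rw [value, this, Finset.sum_insert (by simp), add_comm]
  rfl

theorem measurable_value (M : Market Ω T d) (H : M.Strategy) (t : Fin (T + 1)) :
    Measurable[M.filtration t] (M.value H t) := by
  refine Finset.measurable_fun_sum _ fun j hj => ?_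
  have hj : j.castSucc < t := (Finset.mem_filter.1 hj).2
  have h1 : j.succ ≤ t := Fin.castSucc_lt_iff_succ_le.1 hj
  refine Measurable.inner ((H.predictable j).mono (M.filtration.mono hj.le) le_rfl) ?_
  exact ((M.adapted _).mono (M.filtration.mono h1) le_rfl).sub
    ((M.adapted _).mono (M.filtration.mono hj.le) le_rfl)

/-- Under a martingale measure, a strategy with almost surely nonnegative terminal value has
almost surely vanishing terminal value. -/
theorem value_ae_eq_zero {M : Market Ω T d} {Q : Measure Ω} [IsFiniteMeasure Q]
    (hQ : Martingale M.price M.filtration Q) (H : M.Strategy)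
    (hH : ∀ᵐ x ∂Q, 0 ≤ M.value H (Fin.last T) x) :
    ∀ᵐ x ∂Q, M.value H (Fin.last T) x = 0 := by
  have hnn : ∀ t, ∀ᵐ x ∂Q, 0 ≤ M.value H t x := by
    intro t
    induction t using Fin.reverseInduction with
    | last => exact hH
    | cast i ih =>
      -- Where the current value is negative, a nonnegative next value needs a positive gain, but a
      -- gain nonnegative on this past event vanishes there.
      have h := inner_increment_ae_eq_zero hQ i (H.predictable i)
        (A := {x | M.value H i.castSucc x < 0})
        (measurableSet_lt (M.measurable_value H _) measurable_const) (by
          filter_upwards [ih] with x hx hneg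
          rw [value_succ] at hx
          have hneg : M.value H i.castSucc x < 0 := hneg
          linarith)
      filter_upwards [ih, h] with x hx h0
      by_contra! hneg
      rw [value_succ, h0 hneg] at hx
      linarith
  refine Fin.induction (motive := fun t => ∀ᵐ x ∂Q, M.value H t x = 0)
    (ae_of_all _ (M.value_zero H)) (fun i ih => ?_) (Fin.last T)
  have h := inner_increment_ae_eq_zero hQ i (H.predictable i) (A := univ) MeasurableSet.univ (by
    filter_upwards [ih, hnn i.succ] with x hx hs _
    rwa [value_succ, hx, zero_add] at hs)
  filter_upwards [ih, h] with x hx h0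
  rw [value_succ, hx, h0 (mem_univ x), add_zero]

theorem noOpenArbitrage_of_fullSupportMartingaleMeasures_nonempty [TopologicalSpace Ω]
    {M : Market Ω T d} (hM : M.fullSupportMartingaleMeasures.Nonempty) : M.NoOpenArbitrage := by
  obtain ⟨Q, hQ, hsupp⟩ := hM
  rintro ⟨H, -, hnn, C, ⟨-, hC, x, hx⟩, hsub⟩
  have h0 := value_ae_eq_zero hQ H (ae_of_all _ hnn)
  have hpos : 0 < (Q : Measure Ω) C :=
    (Measure.mem_support_iff_forall x).1 (hsupp ▸ mem_univ x) C (hC.mem_nhds hx)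
  refine hpos.ne' (measure_eq_zero_iff_ae_notMem.2 ?_)
  filter_upwards [h0] with y hy hyC
  exact (hsub hyC : 0 < M.value H (Fin.last T) y).ne' hy

end Market

theorem mainTheorem11 {Ω : Type*} [Nonempty Ω] [TopologicalSpace Ω] [PolishSpace Ω]
    [MeasurableSpace Ω] [BorelSpace Ω] {T d : ℕ} (hT : 1 ≤ T) (hd : 1 ≤ d)
    (M : Market Ω T d) :
    (M.filtration = M.naturalFiltration →
      M.NoOnePointArbitrage → M.fullSupportMartingaleMeasures.Nonempty) ∧
    (M.fullSupportMartingaleMeasures.Nonempty → M.NoOpenArbitrage) :=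
  ⟨fun hnat hM => Market.fullSupportMartingaleMeasures_nonempty hnat hM,
    Market.noOpenArbitrage_of_fullSupportMartingaleMeasures_nonempty⟩
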